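/- Let $1\le p<n$ and let $A\in\mathbb R^{n\times n}$ be symmetric with eigenvalues $\lambda_1\ge\dots\ge\lambda_n$. Put $L=\lambda_1-\lambda_n$ and $c_Q=2/\pi^2$, and assume $\delta=\lambda_p-\lambda_{p+1}>0$. Let $V_\alpha\in\mathbb R^{n\times p}$ have orthonormal columns spanning the invariant subspace of $A$ that belongs to $\lambda_1,\dots,\lambda_p$. For $X\in\mathbb R^{n\times p}$ with $X^TX=I$ let $\phi(X)=-\tfrac12\operatorname{Tr}(X^TAX)$, $\operatorname{grad}\phi(X)=-(AX-XX^TAX)$, $\phi^*=\phi(V_\alpha)$, and let $\operatorname{dist}(X,V_\alpha)=(\theta_1^2+\dots+\theta_p^2)^{1/2}$, where $\theta_1\le\dots\le\theta_p$ in $[0,\pi/2]$ are the principal angles between $\operatorname{span}X$ and $\operatorname{span}V_\alpha$ (the $\cos\theta_i$ are the singular values of $V_\alpha^TX$). Let $X_0,X_1,\dots$ be iterates of Riemannian gradient descent with exact line search: $X_0^TX_0=I$, and, with $G=\operatorname{grad}\phi(X_k)$ and a diagonalization $G^TG=W\operatorname{Diag}(\beta)W^T$ ($W$ orthogonal), $$X_{k+1}=(X_k-\mu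 G)\,W\,(I+\mu^2\operatorname{Diag}(\beta))^{-1/2}\,W^T,$$ where $\mu>0$ minimizes over $(0,\infty)$ the function $$\mu\mapsto-\frac12\sum_{i=1}^p\frac{\alpha_i+2\beta_i\mu+\gamma_i\mu^2}{1+\beta_i\mu^2},\qquad \alpha_i=((X_kW)^TA(X_kW))_{ii},\quad\gamma_i=((GW)^TA(GW))_{ii},$$ which is the value of $\phi$ at the new iterate. Suppose that $$\operatorname{dist}(X_0,V_\alpha)\le\sqrt{\frac{2c_Q\delta}{L}},$$ and write $\Delta=\phi(X_0)-\phi^*$ and $\log^+x=\max\{0,\log x\}$ for $x>0$, $\log^+0=0$. For $\varepsilon>0$ let $$\overline T(\varepsilon)=\frac{5\pi^2L}{8\delta}\,\log^+\frac{\Delta}{c_Q\,\varepsilon^2\,\delta}+1 .$$ Then for every $\varepsilon>0$ there is an integer $0\le T\le\overline T(\varepsilon)$ with $\operatorname{dist}(X_T,V_\alpha)\le\varepsilon$, and moreover $\operatorname{dist}(X_k,V_\alpha)\le\varepsilon$ for all $k\ge T$. Furthermore $\overline T(\varepsilon)=\tilde{\mathcal O}\big(\tfrac L\delta\log\tfrac{\Delta}{\varepsilon}\big)$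 in the following sense: there is an absolute constant $K>0$ (independent of $n$, $p$, $A$, the iterates and $\varepsilon$) such that for all $\varepsilon>0$ $$\overline T(\varepsilon)\le K\,\frac L\delta\Big(\log^+\frac{\Delta}{\varepsilon}+h+1\Big),\qquad h=\begin{cases}\log^+\frac1{\Delta\delta}&(\Delta>0)\\0&(\Delta=0),\end{cases}$$ where the hidden logarithmic term $h$ does not depend on $\varepsilon$; and, if $\Delta>0$, then $\overline T(\varepsilon)\le K\frac L\delta\log\frac\Delta\varepsilon$ for all sufficiently small $\varepsilon>0$ (how small may depend on the instance). -/

import Mathlib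

open Real Filter Topology
open scoped Matrix

namespace SubspaceGD

noncomputable section

variable {n p : ℕ}

/-- The Stiefel manifold: `n × p` matrices with orthonormal columns. An element `X` represents the
point `span X` of the Grassmann manifold `Gr(n, p)`. -/
def Stiefel (n p : ℕ) : Set (Matrix (Fin n) (Fin p) ℝ) := {X | Xᵀ * X = 1}

/-- The cost function `φ(X) = -½ Tr(Xᵀ A X)`. -/
def phi (A : Matrix (Fin n) (Fin n) ℝ) (X : Matrix (Fin n) (Fin p) ℝ) : ℝ :=
  -(1 / 2) * (Xᵀ * A * X).trace

/-- The Riemannian gradient `grad φ(X) = -(A X - X C)` with `C = Xᵀ A X`. -/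
def grad (A : Matrix (Fin n) (Fin n) ℝ) (X : Matrix (Fin n) (Fin p) ℝ) :
    Matrix (Fin n) (Fin p) ℝ :=
  -(A * X - X * (Xᵀ * A * X))

/-- The eigenvalues `λ₁ ≥ λ₂ ≥ ⋯ ≥ λₙ` of the symmetric matrix `A`, counted with multiplicity, in
decreasing order; the index starts at `0`, so `eig hA i` is `λ_{i+1}`. -/
def eig {A : Matrix (Fin n) (Fin n) ℝ} (hA : A.IsHermitian) (i : Fin n) : ℝ :=
  hA.eigenvalues₀ (Fin.cast (Fintype.card_fin n).symm i)

/-- The spectral gap `δ = λ_p - λ_{p+1}` (with `1 ≤ p < n`). -/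
def gap {A : Matrix (Fin n) (Fin n) ℝ} (hA : A.IsHermitian) (hp : 0 < p) (hpn : p < n) : ℝ :=
  eig hA ⟨p - 1, by omega⟩ - eig hA ⟨p, hpn⟩

/-- The spread of the spectrum, `L = λ_max(A) - λ_min(A)`. -/
def spread {A : Matrix (Fin n) (Fin n) ℝ} (hA : A.IsHermitian) (hn : 0 < n) : ℝ :=
  eig hA ⟨0, hn⟩ - eig hA ⟨n - 1, by omega⟩

/-- The constant `c_Q = 2 / π²`. -/
def cQ : ℝ := 2 / π ^ 2

/-- The dominant subspace: the sum of the eigenspaces of `A` for its `p` largest eigenvalues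
`λ₁, …, λ_p`. If `λ_p > λ_{p+1}`, it has dimension `p`. -/
def dominantSubspace {A : Matrix (Fin n) (Fin n) ℝ} (hA : A.IsHermitian) (hpn : p < n) :
    Submodule ℝ (Fin n → ℝ) :=
  ⨆ i : Fin p, Module.End.eigenspace (Matrix.toLin' A) (eig hA (Fin.castLE hpn.le i))

/-- `V` is an orthonormal basis matrix of the dominant subspace: its columns are orthonormal and
span that subspace. -/
def IsDominantBasis {A : Matrix (Fin n) (Fin n) ℝ} (hA : A.IsHermitian) (hpn : p < n)
    (V : Matrix (Fin n) (Fin p) ℝ) : Prop :=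
  V ∈ Stiefel n p ∧ Submodule.span ℝ (Set.range V.col) = dominantSubspace hA hpn

/-- The principal angles `θ₁ ≤ ⋯ ≤ θ_p` between the spans of the orthonormal matrices `X` and `Y`:
their cosines are the singular values (in decreasing order) of the `p × p` matrix `Yᵀ X`. -/
def principalAngle (X Y : Matrix (Fin n) (Fin p) ℝ) (i : Fin p) : ℝ :=
  arccos ((Matrix.toEuclideanLin (Yᵀ * X)).singularValues i)

/-- The intrinsic distance on the Grassmann manifold between the spans of the orthonormal matrices
`X` and `Y`: the Euclidean norm of the vector of principal angles. -/
def grDist (X Y : Matrix (Fin n) (Fin p) ℝ) : ℝ :=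
  √(∑ i, principalAngle X Y i ^ 2)

/-- The line-search objective as a rational function of the step size `μ`,
`-½ ∑ᵢ (αᵢ + 2 βᵢ μ + γᵢ μ²) / (1 + βᵢ μ²)`, where `αᵢ = ((X W)ᵀ A (X W))ᵢᵢ`,
`γᵢ = ((G W)ᵀ A (G W))ᵢᵢ`, `G = grad φ(X)`, and `Gᵀ G = W Diag(β) Wᵀ`. -/
def lineObj (A : Matrix (Fin n) (Fin n) ℝ) (X : Matrix (Fin n) (Fin p) ℝ)
    (W : Matrix (Fin p) (Fin p) ℝ) (β : Fin p → ℝ) (μ : ℝ) : ℝ :=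
  -(1 / 2) * ∑ i,
    (((X * W)ᵀ * A * (X * W)) i i + 2 * β i * μ
        + ((grad A X * W)ᵀ * A * (grad A X * W)) i i * μ ^ 2) / (1 + β i * μ ^ 2)

/-- One step `X ↦ X'` of Riemannian gradient descent with exact line search: diagonalize
`Gᵀ G = W Diag(β) Wᵀ` with `W` orthogonal, let `μ > 0` minimize the line-search objective, and let
`X' = (X - μ G) W (I + μ² Diag(β))^{-1/2} Wᵀ`, the polar factor of `X - μ G`. -/
def IsRGDStep (A : Matrix (Fin n) (Fin n) ℝ) (X X' : Matrix (Fin n) (Fin p) ℝ) : Prop :=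
  ∃ (W : Matrix (Fin p) (Fin p) ℝ) (β : Fin p → ℝ) (μ : ℝ),
    Wᵀ * W = 1 ∧ (grad A X)ᵀ * grad A X = W * Matrix.diagonal β * Wᵀ ∧
    0 < μ ∧ (∀ ν : ℝ, 0 < ν → lineObj A X W β μ ≤ lineObj A X W β ν) ∧
    X' = (X - μ • grad A X) * W * Matrix.diagonal (fun i => (√(1 + μ ^ 2 * β i))⁻¹) * Wᵀ

/-- `X 0, X 1, …` are iterates of Riemannian gradient descent with exact line search, started at a
matrix `X 0` with orthonormal columns. -/
def IsRGDRun (A : Matrix (Fin n) (Fin n) ℝ) (X : ℕ → Matrix (Fin n) (Fin p) ℝ) : Prop :=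
  X 0 ∈ Stiefel n p ∧ ∀ k, IsRGDStep A (X k) (X (k + 1))

/-- The iteration bound `(5 π² L / (8 δ)) · log⁺(Δ / (c_Q ε² δ)) + 1`, with `log⁺ = max(0, log)`. -/
def iterBound (L δ Δ ε : ℝ) : ℝ :=
  5 * π ^ 2 * L / (8 * δ) * log⁺ (Δ / (cQ * ε ^ 2 * δ)) + 1

end

end SubspaceGD

namespace SubspaceGD

open Matrix

/-! Write `f` for the cost gap φ(X) - φ*, `s` for the sum of the squared sines of the principal
angles (`sinSq`), and `g` for the squared Frobenius norm of the gradient. Three estimates combine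
into linear convergence of `f`.

Comparison: an exact trace identity (`trace_sub_trace`) gives δ s ≤ 2 f ≤ L s, and Jordan's
inequality 2θ/π ≤ sin θ ≤ θ turns `s` into the squared distance. Hence c_Q δ dist² ≤ f ≤ (L/2)
dist².

Gradient dominance (`two_mul_gap_mul_le`): if s < 1, then 2 δ (1 - s) f ≤ g. This is Cauchy-Schwarz
between the gradient and a horizontal direction `D` leading from X to a frame of span V, along which
the gradient has inner product exactly -2 f.

Descent (`IsRGDStep.descent`): exact line search does at least as well as the step size 1/L, which
lowers the cost by at least g / (4L).

The hypothesis on the starting point gives f ≤ c_Q δ, so s ≤ 2 c_Q ≤ 4/9. Each step then multiplies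
`f` by at most exp(-(4/5) c_Q δ/L), so the bound on `f` persists and the argument iterates. Once f ≤
c_Q ε² δ, the distance is at most ε. -/

/-! ### Spectral theorem and Rayleigh quotients -/

theorem exists_orthogonal_diagonalization {n : ℕ} {A : Matrix (Fin n) (Fin n) ℝ}
    (hA : A.IsHermitian) :
    ∃ U : Matrix (Fin n) (Fin n) ℝ, Uᵀ * U = 1 ∧ U * Uᵀ = 1 ∧
      A = U * diagonal (eig hA) * Uᵀ := by
  set e : Fin (Fintype.card (Fin n)) ≃ Fin n := Fintype.equivOfCardEq (Fintype.card_fin _)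
  -- `hA.eigenvalues` is indexed through the bijection `e`; permuting the columns of `U₀` by `σ`
  -- restores the decreasing order of `eig`.
  set σ : Fin n ≃ Fin n := (finCongr (Fintype.card_fin n).symm).trans e
  set U₀ : Matrix (Fin n) (Fin n) ℝ := hA.eigenvectorUnitary.1
  have h₁ : U₀ᵀ * U₀ = 1 := by
    have := Unitary.coe_star_mul_self hA.eigenvectorUnitary
    rwa [star_eq_conjTranspose, conjTranspose_eq_transpose_of_trivial] at this
  have h₂ : U₀ * U₀ᵀ = 1 := mul_eq_one_comm.mp h₁
  have h₃ : A = U₀ * diagonal hA.eigenvalues * U₀ᵀ := by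
    conv_lhs => rw [hA.spectral_theorem, Unitary.conjStarAlgAut_apply]
    rw [star_eq_conjTranspose, conjTranspose_eq_transpose_of_trivial]
    rfl
  have hdiag : diagonal (eig hA) = (diagonal hA.eigenvalues).submatrix σ σ := by
    rw [submatrix_diagonal_equiv]
    congr 1
    ext i
    simp [eig, IsHermitian.eigenvalues, σ, e]
  refine ⟨U₀.submatrix id σ, ?_, ?_, ?_⟩
  · rw [transpose_submatrix, submatrix_mul _ _ σ id σ Function.bijective_id |>.symm, h₁,
      submatrix_one_equiv]
  · rw [transpose_submatrix, submatrix_mul_equiv, h₂, submatrix_id_id]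
  · rw [hdiag, transpose_submatrix, submatrix_mul_equiv, submatrix_mul_equiv, submatrix_id_id]
    exact h₃

theorem eig_antitone {n : ℕ} {A : Matrix (Fin n) (Fin n) ℝ} (hA : A.IsHermitian) :
    Antitone (eig hA) := fun i j hij => hA.eigenvalues₀_antitone (by simpa using hij)

section Diagonalized

variable {n : ℕ} {A U : Matrix (Fin n) (Fin n) ℝ} {d : Fin n → ℝ}

theorem dotProduct_mulVec_eq_sum (hU : A = U * diagonal d * Uᵀ) (x : Fin n → ℝ) :
    x ⬝ᵥ A *ᵥ x = ∑ i, d i * (Uᵀ *ᵥ x) i ^ 2 := by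
  subst hU
  rw [← mulVec_mulVec, ← mulVec_mulVec, dotProduct_mulVec, ← mulVec_transpose]
  simp only [dotProduct, mulVec_diagonal]
  exact Finset.sum_congr rfl fun i _ => by ring

theorem dotProduct_self_eq_sum (hU : U * Uᵀ = 1) (x : Fin n → ℝ) :
    x ⬝ᵥ x = ∑ i, (Uᵀ *ᵥ x) i ^ 2 := by
  have h : x ⬝ᵥ (U * Uᵀ) *ᵥ x = x ⬝ᵥ x := by rw [hU, one_mulVec]
  rw [← h, ← mulVec_mulVec, dotProduct_mulVec, ← mulVec_transpose]
  simp only [dotProduct]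
  exact Finset.sum_congr rfl fun i _ => by ring

/-- The alternative for each coordinate lets the bound apply to vectors supported on only part of
the spectrum. -/
theorem le_dotProduct_mulVec (hU : A = U * diagonal d * Uᵀ) (hU' : U * Uᵀ = 1) {a : ℝ}
    (x : Fin n → ℝ) (h : ∀ i, (Uᵀ *ᵥ x) i = 0 ∨ a ≤ d i) :
    a * (x ⬝ᵥ x) ≤ x ⬝ᵥ A *ᵥ x := by
  rw [dotProduct_mulVec_eq_sum hU, dotProduct_self_eq_sum hU', Finset.mul_sum]
  refine Finset.sum_le_sum fun i _ => ?_
  rcases h i with h | h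
  · simp [h]
  · gcongr

theorem dotProduct_mulVec_le (hU : A = U * diagonal d * Uᵀ) (hU' : U * Uᵀ = 1) {b : ℝ}
    (x : Fin n → ℝ) (h : ∀ i, (Uᵀ *ᵥ x) i = 0 ∨ d i ≤ b) :
    x ⬝ᵥ A *ᵥ x ≤ b * (x ⬝ᵥ x) := by
  rw [dotProduct_mulVec_eq_sum hU, dotProduct_self_eq_sum hU', Finset.mul_sum]
  refine Finset.sum_le_sum fun i _ => ?_
  rcases h i with h | h
  · simp [h]
  · gcongr

theorem mulVec_col_eq (hU : A = U * diagonal d * Uᵀ) (hU' : Uᵀ * U = 1) (i : Fin n) :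
    A *ᵥ U.col i = d i • U.col i := by
  have h : A * U = U * diagonal d := by rw [hU, Matrix.mul_assoc, hU', Matrix.mul_one]
  ext j
  have := congrFun (congrFun h j) i
  rw [mul_diagonal] at this
  simpa [mulVec, dotProduct, Matrix.mul_apply, mul_comm] using this

theorem transpose_mulVec_mulVec (hU : A = U * diagonal d * Uᵀ) (hU' : Uᵀ * U = 1)
    (x : Fin n → ℝ) (i : Fin n) : (Uᵀ *ᵥ (A *ᵥ x)) i = d i * (Uᵀ *ᵥ x) i := by
  rw [mulVec_mulVec, hU, ← Matrix.mul_assoc, ← Matrix.mul_assoc, hU', Matrix.one_mul,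
    ← mulVec_mulVec, mulVec_diagonal]

end Diagonalized

/-- The spectral data of a symmetric matrix `A` relative to an orthonormal frame `V` of an
invariant subspace: `lo` and `hi` bound the whole spectrum, `a` bounds it from below on the span
of `V`, and `b` bounds it from above on the orthogonal complement. -/
structure SpectralSplit {n p : ℕ} (A : Matrix (Fin n) (Fin n) ℝ) (V : Matrix (Fin n) (Fin p) ℝ)
    (lo b a hi : ℝ) : Prop where
  symm : Aᵀ = A
  orth : Vᵀ * V = 1
  invariant : A * V = V * (Vᵀ * A * V)
  lo_le : ∀ x, lo * (x ⬝ᵥ x) ≤ x ⬝ᵥ A *ᵥ x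
  le_hi : ∀ x, x ⬝ᵥ A *ᵥ x ≤ hi * (x ⬝ᵥ x)
  le_on : ∀ y, a * ((V *ᵥ y) ⬝ᵥ (V *ᵥ y)) ≤ (V *ᵥ y) ⬝ᵥ A *ᵥ (V *ᵥ y)
  on_le : ∀ x, Vᵀ *ᵥ x = 0 → x ⬝ᵥ A *ᵥ x ≤ b * (x ⬝ᵥ x)

theorem IsDominantBasis.spectralSplit {n p : ℕ} {A : Matrix (Fin n) (Fin n) ℝ}
    (hA : A.IsHermitian) (hp : 0 < p) (hpn : p < n) (hgap : 0 < gap hA hp hpn)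
    {V : Matrix (Fin n) (Fin p) ℝ} (hV : IsDominantBasis hA hpn V) :
    SpectralSplit A V (eig hA ⟨n - 1, by omega⟩) (eig hA ⟨p, hpn⟩) (eig hA ⟨p - 1, by omega⟩)
      (eig hA ⟨0, hp.trans hpn⟩) := by
  obtain ⟨U, hU₁, hU₂, hU⟩ := exists_orthogonal_diagonalization hA
  have hmem (x : Fin n → ℝ) : x ∈ dominantSubspace hA hpn ↔
      ∃ y, V *ᵥ y = x := by
    rw [← hV.2, ← range_mulVecLin]
    simp
  have hsmall (x : Fin n → ℝ) (hx : x ∈ dominantSubspace hA hpn) (j : Fin n) (hj : p ≤ j) :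
      (Uᵀ *ᵥ x) j = 0 := by
    have hle : dominantSubspace hA hpn ≤
        LinearMap.ker (LinearMap.proj j ∘ₗ Uᵀ.mulVecLin) := by
      refine iSup_le fun i y hy => ?_
      rw [Module.End.mem_eigenspace_iff, toLin'_apply] at hy
      have h₁ := transpose_mulVec_mulVec hU hU₁ y j
      rw [hy, mulVec_smul] at h₁
      have h₂ : eig hA ⟨p - 1, by omega⟩ ≤ eig hA (Fin.castLE hpn.le i) :=
        eig_antitone hA (by rw [Fin.le_def]; simp; omega)
      have h₃ : eig hA j ≤ eig hA ⟨p, hpn⟩ := eig_antitone hA (by rw [Fin.le_def]; exact hj)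
      -- The strict gap matters here: it makes eigenvectors for the top `p` eigenvalues orthogonal
      -- to the remaining columns of `U`.
      have h₄ : eig hA j ≠ eig hA (Fin.castLE hpn.le i) := by
        unfold gap at hgap
        intro h
        linarith
      have h₅ : (eig hA j - eig hA (Fin.castLE hpn.le i)) * (Uᵀ *ᵥ y) j = 0 := by
        simp only [Pi.smul_apply, smul_eq_mul] at h₁
        linarith
      exact (mul_eq_zero.mp h₅).resolve_left (sub_ne_zero.mpr h₄)
    exact hle hx
  have hlarge (i : Fin n) (hi : (i : ℕ) < p) : U.col i ∈ dominantSubspace hA hpn := by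
    refine Submodule.mem_iSup_of_mem (⟨i, hi⟩ : Fin p) ?_
    rw [Module.End.mem_eigenspace_iff, toLin'_apply, mulVec_col_eq hU hU₁]
    rfl
  have hdom (y : Fin p → ℝ) : V *ᵥ y ∈ dominantSubspace hA hpn := (hmem _).2 ⟨y, rfl⟩
  refine ⟨by simpa [conjTranspose_eq_transpose_of_trivial] using hA.eq, hV.1, ?_, fun x => ?_,
    fun x => ?_, fun y => ?_, fun x hx => ?_⟩
  · have hinv : ∀ x ∈ dominantSubspace hA hpn, A *ᵥ x ∈ dominantSubspace hA hpn := by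
      have : dominantSubspace hA hpn ≤ (dominantSubspace hA hpn).comap A.mulVecLin := by
        refine iSup_le fun i y hy => ?_
        have hy' := hy
        rw [Module.End.mem_eigenspace_iff, toLin'_apply] at hy'
        simp only [Submodule.mem_comap, mulVecLin_apply, hy']
        exact Submodule.smul_mem _ _ (Submodule.mem_iSup_of_mem i hy)
      exact fun x hx => this hx
    have hcol (y : Fin p → ℝ) : (A * V) *ᵥ y = (V * (Vᵀ * A * V)) *ᵥ y := by
      obtain ⟨z, hz⟩ := (hmem _).1 (hinv _ (hdom y))
      have : Vᵀ *ᵥ (V *ᵥ z) = z := by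
        rw [mulVec_mulVec, show Vᵀ * V = 1 from hV.1, one_mulVec]
      rw [← mulVec_mulVec, ← mulVec_mulVec, ← mulVec_mulVec, ← mulVec_mulVec, ← hz, this]
    exact ext_of_mulVec_single fun i => hcol _
  · exact le_dotProduct_mulVec hU hU₂ x fun i => .inr <|
      eig_antitone hA (by rw [Fin.le_def]; simp; omega)
  · exact dotProduct_mulVec_le hU hU₂ x fun i => .inr <|
      eig_antitone hA (by rw [Fin.le_def]; simp)
  · refine le_dotProduct_mulVec hU hU₂ _ fun i => ?_
    rcases le_or_gt p i with hi | hi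
    · exact .inl (hsmall _ (hdom y) i hi)
    · exact .inr (eig_antitone hA (by rw [Fin.le_def]; simp; omega))
  · refine dotProduct_mulVec_le hU hU₂ _ fun i => ?_
    rcases le_or_gt p i with hi | hi
    · exact .inr (eig_antitone hA (by rw [Fin.le_def]; exact hi))
    · left
      obtain ⟨y, hy⟩ := (hmem _).1 (hlarge i hi)
      have : (Uᵀ *ᵥ x) i = U.col i ⬝ᵥ x := rfl
      rw [this, ← hy, dotProduct_comm, dotProduct_mulVec, ← mulVec_transpose, hx, zero_dotProduct]

/-! ### Trace inequalities, column by column -/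

theorem trace_transpose_mul_mul {m k : ℕ} (M : Matrix (Fin m) (Fin m) ℝ)
    (Y : Matrix (Fin m) (Fin k) ℝ) : (Yᵀ * M * Y).trace = ∑ j, Y.col j ⬝ᵥ M *ᵥ Y.col j := by
  refine Finset.sum_congr rfl fun j _ => ?_
  rw [Matrix.mul_assoc]
  rfl

theorem trace_transpose_mul_self {m k : ℕ} (Y : Matrix (Fin m) (Fin k) ℝ) :
    (Yᵀ * Y).trace = ∑ j, Y.col j ⬝ᵥ Y.col j := rfl

theorem trace_transpose_mul_self_nonneg {m k : ℕ} (Y : Matrix (Fin m) (Fin k) ℝ) :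
    0 ≤ (Yᵀ * Y).trace := by
  rw [trace_transpose_mul_self]
  exact Finset.sum_nonneg fun j _ => Finset.sum_nonneg fun i _ => mul_self_nonneg _

theorem mul_trace_le_trace {m k : ℕ} {M : Matrix (Fin m) (Fin m) ℝ}
    {Y : Matrix (Fin m) (Fin k) ℝ} {a : ℝ}
    (h : ∀ j, a * (Y.col j ⬝ᵥ Y.col j) ≤ Y.col j ⬝ᵥ M *ᵥ Y.col j) :
    a * (Yᵀ * Y).trace ≤ (Yᵀ * M * Y).trace := by
  rw [trace_transpose_mul_mul, trace_transpose_mul_self, Finset.mul_sum]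
  exact Finset.sum_le_sum fun j _ => h j

theorem trace_le_mul_trace {m k : ℕ} {M : Matrix (Fin m) (Fin m) ℝ}
    {Y : Matrix (Fin m) (Fin k) ℝ} {a : ℝ}
    (h : ∀ j, Y.col j ⬝ᵥ M *ᵥ Y.col j ≤ a * (Y.col j ⬝ᵥ Y.col j)) :
    (Yᵀ * M * Y).trace ≤ a * (Yᵀ * Y).trace := by
  rw [trace_transpose_mul_mul, trace_transpose_mul_self, Finset.mul_sum]
  exact Finset.sum_le_sum fun j _ => h j

theorem trace_transpose_mul_sq_le {m k : ℕ} (Y Z : Matrix (Fin m) (Fin k) ℝ) :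
    (Yᵀ * Z).trace ^ 2 ≤ (Yᵀ * Y).trace * (Zᵀ * Z).trace := by
  have h (Y Z : Matrix (Fin m) (Fin k) ℝ) :
      (Yᵀ * Z).trace = ∑ q : Fin k × Fin m, Y q.2 q.1 * Z q.2 q.1 := by
    rw [Fintype.sum_prod_type]
    rfl
  simpa [h, sq] using Finset.sum_mul_sq_le_sq_mul_sq Finset.univ
    (fun q : Fin k × Fin m => Y q.2 q.1) (fun q => Z q.2 q.1)

theorem dotProduct_mulVec_le_trace {m k : ℕ} (C : Matrix (Fin m) (Fin k) ℝ) (y : Fin k → ℝ) :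
    (C *ᵥ y) ⬝ᵥ (C *ᵥ y) ≤ (Cᵀ * C).trace * (y ⬝ᵥ y) := by
  have h : (Cᵀ * C).trace = ∑ i, ∑ j, C i j ^ 2 := by
    rw [Finset.sum_comm, trace_transpose_mul_self]
    exact Finset.sum_congr rfl fun j _ => Finset.sum_congr rfl fun i _ => (sq _).symm
  rw [h, Finset.sum_mul]
  refine Finset.sum_le_sum fun i _ => ?_
  have := Finset.sum_mul_sq_le_sq_mul_sq Finset.univ (C i) y
  simpa [mulVec, dotProduct, sq] using this

/-- The sum of the squared sines of the principal angles between the spans of `X` and `V`. -/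
noncomputable def sinSq {n p : ℕ} (X V : Matrix (Fin n) (Fin p) ℝ) : ℝ :=
  p - ((Vᵀ * X)ᵀ * (Vᵀ * X)).trace

/-! ### Projection residuals and the sum of squared sines -/

section Residual

variable {n p : ℕ} {X V : Matrix (Fin n) (Fin p) ℝ}

theorem residual_transpose_mul_self (hX : Xᵀ * X = 1) (hV : Vᵀ * V = 1) :
    (X - V * (Vᵀ * X))ᵀ * (X - V * (Vᵀ * X)) = 1 - (Vᵀ * X)ᵀ * (Vᵀ * X) := by
  have h : (Vᵀ * X)ᵀ * (Vᵀ * (V * (Vᵀ * X))) = (Vᵀ * X)ᵀ * (Vᵀ * X) := by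
    rw [← Matrix.mul_assoc Vᵀ V, hV, Matrix.one_mul]
  rw [transpose_sub, Matrix.sub_mul, Matrix.mul_sub, Matrix.mul_sub, hX, transpose_mul V,
    Matrix.mul_assoc _ Vᵀ X, Matrix.mul_assoc _ Vᵀ (V * _), h, transpose_mul, transpose_transpose]
  simp only [Matrix.mul_assoc]
  abel

theorem transpose_mul_residual (hV : Vᵀ * V = 1) : Vᵀ * (X - V * (Vᵀ * X)) = 0 := by
  rw [Matrix.mul_sub, ← Matrix.mul_assoc Vᵀ V, hV, Matrix.one_mul, sub_self]

theorem trace_residual (hX : Xᵀ * X = 1) (hV : Vᵀ * V = 1) :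
    ((X - V * (Vᵀ * X))ᵀ * (X - V * (Vᵀ * X))).trace = sinSq X V := by
  rw [residual_transpose_mul_self hX hV, trace_sub, trace_one, sinSq, Fintype.card_fin]

theorem sinSq_comm : sinSq X V = sinSq V X := by
  rw [sinSq, sinSq, trace_mul_comm]
  simp only [transpose_mul, transpose_transpose]

theorem sinSq_nonneg (hX : Xᵀ * X = 1) (hV : Vᵀ * V = 1) : 0 ≤ sinSq X V := by
  rw [← trace_residual hX hV]
  exact trace_transpose_mul_self_nonneg _

/-- The Gram matrix of the residual is I - BᵀB with B = VᵀX; it is positive semidefinite with trace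
`sinSq X V`, so no eigenvalue exceeds that trace. -/
theorem mul_dotProduct_le_of_sinSq (hX : Xᵀ * X = 1) (hV : Vᵀ * V = 1) (y : Fin p → ℝ) :
    (1 - sinSq X V) * (y ⬝ᵥ y) ≤ y ⬝ᵥ ((Vᵀ * X)ᵀ * (Vᵀ * X)) *ᵥ y := by
  have h := dotProduct_mulVec_le_trace (X - V * (Vᵀ * X)) y
  rw [trace_residual hX hV, dotProduct_mulVec, ← mulVec_transpose, mulVec_mulVec,
    residual_transpose_mul_self hX hV, dotProduct_comm, sub_mulVec, one_mulVec,
    dotProduct_sub] at h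
  linarith

end Residual

theorem grad_transpose_mul_self {n p : ℕ} {A : Matrix (Fin n) (Fin n) ℝ}
    {X : Matrix (Fin n) (Fin p) ℝ} (hX : Xᵀ * X = 1) : (grad A X)ᵀ * X = 0 := by
  rw [← transpose_transpose ((grad A X)ᵀ * X), transpose_mul, transpose_transpose, grad,
    Matrix.mul_neg, Matrix.mul_sub, ← Matrix.mul_assoc Xᵀ X, hX, Matrix.one_mul,
    ← Matrix.mul_assoc, sub_self, neg_zero, transpose_zero]

/-! ### Cost gap versus squared sines; gradient dominance -/

namespace SpectralSplit

variable {n p : ℕ} {A : Matrix (Fin n) (Fin n) ℝ} {X V : Matrix (Fin n) (Fin p) ℝ}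
  {lo b a hi : ℝ}

/-- Split X = V B + C with VᵀC = 0. Invariance of span V kills the cross terms, and what V B misses
of the trace of H = VᵀAV is Tr(H (I - BBᵀ)), where I - BBᵀ is the Gram matrix of V - X XᵀV. Both
terms on the right are traces over matrices of squared Frobenius norm `sinSq X V`, the first with
columns in span V, the second with columns orthogonal to it. -/
theorem trace_sub_trace (h : SpectralSplit A V lo b a hi) (hX : Xᵀ * X = 1) :
    (Vᵀ * A * V).trace - (Xᵀ * A * X).trace =
      ((V * (V - X * (Xᵀ * V))ᵀ)ᵀ * A * (V * (V - X * (Xᵀ * V))ᵀ)).trace -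
        ((X - V * (Vᵀ * X))ᵀ * A * (X - V * (Vᵀ * X))).trace := by
  set E := V - X * (Xᵀ * V)
  have hE : Eᵀ * E = 1 - (Xᵀ * V)ᵀ * (Xᵀ * V) := residual_transpose_mul_self h.orth hX
  have hVC : Vᵀ * (X - V * (Vᵀ * X)) = 0 := transpose_mul_residual h.orth
  set B := Vᵀ * X with hB
  have hBt : Xᵀ * V = Bᵀ := by simp [hB]
  have hXC : X = V * B + (X - V * B) := by abel
  generalize X - V * B = C at *
  have hCV : Cᵀ * V = 0 := by
    rw [← transpose_transpose (Cᵀ * V), transpose_mul, transpose_transpose, hVC, transpose_zero]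
  set H := Vᵀ * A * V with hH
  have h₁ : Cᵀ * (A * V) = 0 := by
    rw [h.invariant, ← Matrix.mul_assoc, hCV, Matrix.zero_mul]
  have h₂ : Vᵀ * (A * C) = 0 := by
    have e : (Vᵀ * (A * C))ᵀ = 0 := by
      rw [transpose_mul, transpose_mul, h.symm, transpose_transpose, Matrix.mul_assoc, h₁]
    rw [← transpose_transpose (Vᵀ * (A * C)), e, transpose_zero]
  have h₃ : Xᵀ * A * X = Bᵀ * H * B + Cᵀ * A * C := by
    have e₁ : Bᵀ * Vᵀ * A * C = Bᵀ * (Vᵀ * (A * C)) := by simp only [Matrix.mul_assoc]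
    have e₂ : Cᵀ * A * (V * B) = Cᵀ * (A * V) * B := by simp only [Matrix.mul_assoc]
    have e₃ : Bᵀ * Vᵀ * A * (V * B) = Bᵀ * H * B := by simp only [hH, Matrix.mul_assoc]
    rw [hXC, transpose_add, transpose_mul, Matrix.add_mul, Matrix.add_mul, Matrix.mul_add,
      Matrix.mul_add, e₁, e₂, e₃, h₁, h₂, Matrix.mul_zero, Matrix.zero_mul, add_zero, zero_add]
  have h₄ : ((V * Eᵀ)ᵀ * A * (V * Eᵀ)).trace = (H * (Eᵀ * E)).trace := by
    have e : (V * Eᵀ)ᵀ * A * (V * Eᵀ) = E * (H * Eᵀ) := by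
      simp only [hH, transpose_mul, transpose_transpose, Matrix.mul_assoc]
    rw [e, trace_mul_comm, Matrix.mul_assoc]
  rw [h₃, h₄, hE, Matrix.mul_sub, trace_sub, trace_add, Matrix.mul_one, hBt, transpose_transpose,
    trace_mul_cycle Bᵀ H B, trace_mul_comm (B * Bᵀ) H]
  ring

theorem transpose_mul_mul_residual (h : SpectralSplit A V lo b a hi) (hX : Xᵀ * X = 1) :
    ((V * (V - X * (Xᵀ * V))ᵀ)ᵀ * (V * (V - X * (Xᵀ * V))ᵀ)).trace = sinSq X V := by
  set E := V - X * (Xᵀ * V) with hE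
  have e : (V * Eᵀ)ᵀ * (V * Eᵀ) = E * ((Vᵀ * V) * Eᵀ) := by
    simp only [transpose_mul, transpose_transpose, Matrix.mul_assoc]
  rw [e, h.orth, Matrix.one_mul, trace_mul_comm, hE, trace_residual h.orth hX, sinSq_comm]

theorem gap_mul_sinSq_le (h : SpectralSplit A V lo b a hi) (hX : Xᵀ * X = 1) :
    (a - b) * sinSq X V ≤ 2 * (phi A X - phi A V) := by
  have h₁ := h.trace_sub_trace hX
  have h₂ : a * _ ≤ ((V * (V - X * (Xᵀ * V))ᵀ)ᵀ * A * (V * (V - X * (Xᵀ * V))ᵀ)).trace :=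
    mul_trace_le_trace fun j => h.le_on ((V - X * (Xᵀ * V))ᵀ.col j)
  have h₃ : ((X - V * (Vᵀ * X))ᵀ * A * (X - V * (Vᵀ * X))).trace ≤ b * _ :=
    trace_le_mul_trace fun j => h.on_le _ <|
      congrArg (fun M : Matrix (Fin p) (Fin p) ℝ => M.col j) (transpose_mul_residual h.orth)
  rw [h.transpose_mul_mul_residual hX] at h₂
  rw [trace_residual hX h.orth] at h₃
  unfold phi
  linarith

theorem le_spread_mul_sinSq (h : SpectralSplit A V lo b a hi) (hX : Xᵀ * X = 1) :
    2 * (phi A X - phi A V) ≤ (hi - lo) * sinSq X V := by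
  have h₁ := h.trace_sub_trace hX
  have h₂ : ((V * (V - X * (Xᵀ * V))ᵀ)ᵀ * A * (V * (V - X * (Xᵀ * V))ᵀ)).trace ≤ hi * _ :=
    trace_le_mul_trace fun j => h.le_hi _
  have h₃ : lo * _ ≤ ((X - V * (Vᵀ * X))ᵀ * A * (X - V * (Vᵀ * X))).trace :=
    mul_trace_le_trace fun j => h.lo_le _
  rw [h.transpose_mul_mul_residual hX] at h₂
  rw [trace_residual hX h.orth] at h₃
  unfold phi
  linarith

theorem exists_right_inverse (h : SpectralSplit A V lo b a hi) (hX : Xᵀ * X = 1)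
    (hs : sinSq X V < 1) :
    ∃ N : Matrix (Fin p) (Fin p) ℝ, (Xᵀ * V) * N = 1 ∧ N * (Xᵀ * V) = 1 := by
  have hinj : Function.Injective (Vᵀ * X).mulVec := by
    refine (injective_iff_map_eq_zero (Vᵀ * X).mulVecLin).2 fun y hy => ?_
    have h₁ := mul_dotProduct_le_of_sinSq hX h.orth y
    rw [mulVecLin_apply] at hy
    rw [← mulVec_mulVec, hy, mulVec_zero, dotProduct_zero] at h₁
    have h₂ : 0 ≤ y ⬝ᵥ y := Finset.sum_nonneg fun i _ => mul_self_nonneg _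
    exact dotProduct_self_eq_zero.mp (by nlinarith)
  have hu : IsUnit (Xᵀ * V) := by
    have := (isUnit_transpose (Vᵀ * X)).2 (mulVec_injective_iff_isUnit.1 hinj)
    rwa [transpose_mul, transpose_transpose] at this
  obtain ⟨u, hu⟩ := hu
  exact ⟨(u⁻¹ : _ˣ), by simp [← hu], by simp [← hu]⟩

/-- The Polyak-Łojasiewicz inequality for `phi`. -/
theorem two_mul_gap_mul_le (h : SpectralSplit A V lo b a hi) (hX : Xᵀ * X = 1) (hab : b ≤ a)
    (hs : sinSq X V < 1) :
    2 * (a - b) * (1 - sinSq X V) * (phi A X - phi A V) ≤ ((grad A X)ᵀ * grad A X).trace := by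
  obtain ⟨N, hN₁, hN₂⟩ := h.exists_right_inverse hX hs
  set s := sinSq X V with hsdef
  set G := grad A X with hG
  set E := V - X * (Xᵀ * V) with hE
  -- Since X + D = V N, this is the horizontal vector at X that leads to a frame of span V.
  set D := E * N with hD
  have hDV : D = V * N - X := by
    rw [hD, hE, Matrix.sub_mul, Matrix.mul_assoc X, hN₁, Matrix.mul_one]
  have hGX : Gᵀ * X = 0 := grad_transpose_mul_self hX
  have hGD : (Gᵀ * D).trace = -(2 * (phi A X - phi A V)) := by
    set B := Xᵀ * V
    set H := Vᵀ * A * V with hH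
    have e : Gᵀ * D = Xᵀ * A * X * (B * N) - B * H * N := by
      have e₁ : B * H * N = Xᵀ * (A * V) * N := by
        rw [h.invariant]
        simp only [B, H, Matrix.mul_assoc]
      rw [hDV, Matrix.mul_sub, hGX, sub_zero, hG, grad, transpose_neg, transpose_sub,
        transpose_mul, transpose_mul X, transpose_mul, transpose_mul, h.symm,
        transpose_transpose, e₁, Matrix.neg_mul, Matrix.sub_mul]
      simp only [B, Matrix.mul_assoc]
      abel
    rw [e, hN₁, Matrix.mul_one, trace_sub, Matrix.mul_assoc B, trace_mul_comm B, Matrix.mul_assoc H,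
      hN₂, Matrix.mul_one, hH]
    unfold phi
    ring
  have hcs := trace_transpose_mul_sq_le G D
  -- E = D XᵀV has squared norm s, and the squared singular values of XᵀV are at least 1 - s.
  have hDs : (1 - s) * (Dᵀ * D).trace ≤ s := by
    have h₁ := mul_trace_le_trace (Y := Dᵀ)
      (fun j => mul_dotProduct_le_of_sinSq hX h.orth (Dᵀ.col j))
    have e : Dᵀᵀ * ((Vᵀ * X)ᵀ * (Vᵀ * X)) * Dᵀ = E * Eᵀ := by
      have e₁ : D * (Vᵀ * X)ᵀ = E := by
        rw [transpose_mul, transpose_transpose, hD, Matrix.mul_assoc, hN₂, Matrix.mul_one]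
      conv_rhs => rw [← e₁]
      rw [transpose_mul D, transpose_transpose, transpose_transpose]
      simp only [Matrix.mul_assoc]
    rw [e, trace_mul_comm E, hE, trace_residual h.orth hX, transpose_transpose,
      trace_mul_comm D, sinSq_comm (X := V), ← hsdef] at h₁
    exact h₁
  have h₁ := h.gap_mul_sinSq_le hX
  have h₂ := h.le_spread_mul_sinSq hX
  have hs₀ : 0 ≤ s := sinSq_nonneg hX h.orth
  have hg := trace_transpose_mul_self_nonneg G
  rw [hGD, neg_sq] at hcs
  rw [← hsdef] at h₁ h₂
  set f := phi A X - phi A V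
  set g := (Gᵀ * G).trace
  have hf : 0 ≤ f := by nlinarith [mul_nonneg (sub_nonneg.2 hab) hs₀]
  -- Cauchy-Schwarz yields the claim multiplied by s; when s = 0 division is impossible, but then f
  -- = 0.
  rcases hs₀.eq_or_lt with h0 | hpos
  · rw [← h0] at h₂
    have : f = 0 := by linarith
    rw [this, mul_zero]
    exact hg
  · have h₃ : (1 - s) * (2 * f) ^ 2 ≤ g * s := by
      calc (1 - s) * (2 * f) ^ 2 ≤ (1 - s) * (g * (Dᵀ * D).trace) :=
            mul_le_mul_of_nonneg_left hcs (by linarith)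
        _ = g * ((1 - s) * (Dᵀ * D).trace) := by ring
        _ ≤ g * s := mul_le_mul_of_nonneg_left hDs hg
    have h₄ : ((a - b) * s) * ((1 - s) * f) ≤ 2 * f * ((1 - s) * f) :=
      mul_le_mul_of_nonneg_right h₁ (mul_nonneg (by linarith) hf)
    refine le_of_mul_le_mul_right ?_ hpos
    linarith

end SpectralSplit

/-! ### Singular values, principal angles and distance -/

theorem sum_sq_singularValues {m k : ℕ} (B : Matrix (Fin m) (Fin k) ℝ) :
    ∑ i : Fin k, (toEuclideanLin B).singularValues i ^ 2 = (Bᵀ * B).trace := by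
  have hn : Module.finrank ℝ (EuclideanSpace ℝ (Fin k)) = k := by simp
  simp_rw [LinearMap.sq_singularValues_fin _ hn]
  have h := LinearMap.IsSymmetric.trace_eq_sum_eigenvalues hn
    (toEuclideanLin B).isSymmetric_adjoint_comp_self
  have e : (toEuclideanLin B).adjoint ∘ₗ toEuclideanLin B = toEuclideanLin (Bᵀ * B) := by
    rw [← toEuclideanLin_conjTranspose_eq_adjoint, conjTranspose_eq_transpose_of_trivial]
    ext x i
    simp [toLpLin_apply]
  exact h.symm.trans <| (congrArg _ e).trans (trace_toLin_eq (Bᵀ * B) (EuclideanSpace.basisFun (Fin k) ℝ).toBasis)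

theorem singularValues_le_one {m k : ℕ} {B : Matrix (Fin m) (Fin k) ℝ}
    (hB : ∀ y, (B *ᵥ y) ⬝ᵥ (B *ᵥ y) ≤ y ⬝ᵥ y) (i : Fin k) :
    (toEuclideanLin B).singularValues i ≤ 1 := by
  have hn : Module.finrank ℝ (EuclideanSpace ℝ (Fin k)) = k := by simp
  have hlt : (i : ℕ) < Module.finrank ℝ (EuclideanSpace ℝ (Fin k)) := by simp
  obtain ⟨v, hv⟩ :=
    ((toEuclideanLin B).hasEigenvalue_adjoint_comp_self_sq_singularValues hlt).exists_hasEigenvector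
  set σ := (toEuclideanLin B).singularValues i
  have h₁ : ‖toEuclideanLin B v‖ ^ 2 = σ ^ 2 * ‖v‖ ^ 2 := by
    rw [← real_inner_self_eq_norm_sq, ← LinearMap.adjoint_inner_right]
    have := hv.apply_eq_smul
    rw [LinearMap.comp_apply] at this
    rw [this]
    simp [real_inner_smul_right]
  have h₂ : ‖toEuclideanLin B v‖ ^ 2 ≤ ‖v‖ ^ 2 := by
    have := hB v.ofLp
    rw [EuclideanSpace.real_norm_sq_eq, EuclideanSpace.real_norm_sq_eq]
    simpa only [toLpLin_apply, dotProduct, ← sq] using this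
  have h₃ : 0 < ‖v‖ := norm_pos_iff.2 hv.2
  rw [h₁] at h₂
  have h₄ : σ ^ 2 ≤ 1 := by
    by_contra hc
    nlinarith [sq_pos_of_pos h₃]
  exact (sq_le_one_iff_abs_le_one σ).1 h₄ |> fun h => (abs_le.1 h).2

theorem one_sub_sq_le_arccos_sq {x : ℝ} (h₀ : 0 ≤ x) (h₁ : x ≤ 1) :
    1 - x ^ 2 ≤ arccos x ^ 2 := by
  have h := sin_le (arccos_nonneg x)
  have h' : 0 ≤ 1 - x ^ 2 := by nlinarith
  rw [sin_arccos] at h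
  calc 1 - x ^ 2 = √(1 - x ^ 2) ^ 2 := (sq_sqrt h').symm
    _ ≤ arccos x ^ 2 := by gcongr

/-- Jordan's inequality, squared; this is the source of c_Q, as 2 c_Q = (2/π)². -/
theorem arccos_sq_le {x : ℝ} (h₀ : 0 ≤ x) (h₁ : x ≤ 1) :
    2 * cQ * arccos x ^ 2 ≤ 1 - x ^ 2 := by
  have h := mul_le_sin (arccos_nonneg x) (arccos_le_pi_div_two.2 h₀)
  have h' : 0 ≤ 1 - x ^ 2 := by nlinarith
  rw [sin_arccos] at h
  have h'' : 0 ≤ 2 / π * arccos x := mul_nonneg (by positivity) (arccos_nonneg x)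
  calc 2 * cQ * arccos x ^ 2 = (2 / π * arccos x) ^ 2 := by unfold cQ; ring
    _ ≤ √(1 - x ^ 2) ^ 2 := by gcongr
    _ = 1 - x ^ 2 := sq_sqrt h'

section Distance

variable {n p : ℕ} {X V : Matrix (Fin n) (Fin p) ℝ}

theorem cosine_le_one (hX : Xᵀ * X = 1) (hV : Vᵀ * V = 1) (i : Fin p) :
    (toEuclideanLin (Vᵀ * X)).singularValues i ≤ 1 := by
  refine singularValues_le_one (fun y => ?_) i
  have h : 0 ≤ ((X - V * (Vᵀ * X)) *ᵥ y) ⬝ᵥ ((X - V * (Vᵀ * X)) *ᵥ y) :=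
    Finset.sum_nonneg fun i _ => mul_self_nonneg _
  rw [dotProduct_mulVec, ← mulVec_transpose, mulVec_mulVec,
    residual_transpose_mul_self hX hV, dotProduct_comm, sub_mulVec, one_mulVec,
    dotProduct_sub, ← mulVec_mulVec, dotProduct_mulVec, ← mulVec_transpose,
    transpose_transpose] at h
  linarith

theorem sum_one_sub_cosine_sq :
    ∑ i : Fin p, (1 - (toEuclideanLin (Vᵀ * X)).singularValues i ^ 2) = sinSq X V := by
  rw [Finset.sum_sub_distrib, sum_sq_singularValues, sinSq]
  simp

theorem grDist_sq : grDist X V ^ 2 = ∑ i, principalAngle X V i ^ 2 :=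
  sq_sqrt (Finset.sum_nonneg fun _ _ => sq_nonneg _)

theorem sinSq_le_grDist_sq (hX : Xᵀ * X = 1) (hV : Vᵀ * V = 1) :
    sinSq X V ≤ grDist X V ^ 2 := by
  rw [grDist_sq, ← sum_one_sub_cosine_sq]
  exact Finset.sum_le_sum fun i _ =>
    one_sub_sq_le_arccos_sq (LinearMap.singularValues_nonneg _ _) (cosine_le_one hX hV i)

theorem grDist_sq_le (hX : Xᵀ * X = 1) (hV : Vᵀ * V = 1) :
    2 * cQ * grDist X V ^ 2 ≤ sinSq X V := by
  rw [grDist_sq, ← sum_one_sub_cosine_sq, Finset.mul_sum]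
  exact Finset.sum_le_sum fun i _ =>
    arccos_sq_le (LinearMap.singularValues_nonneg _ _) (cosine_le_one hX hV i)

end Distance

/-! ### Line search and the decrease per step -/

/-- A X = X C - G, and G is orthogonal to X. -/
theorem grad_transpose_mul_mul_self {n p : ℕ} {A : Matrix (Fin n) (Fin n) ℝ}
    {X : Matrix (Fin n) (Fin p) ℝ} (hX : Xᵀ * X = 1) :
    (grad A X)ᵀ * (A * X) = -((grad A X)ᵀ * grad A X) := by
  conv_rhs => rw [grad.eq_def A X, Matrix.mul_neg, Matrix.mul_sub, neg_neg]
  rw [← grad.eq_def A X, ← Matrix.mul_assoc _ X, grad_transpose_mul_self hX, Matrix.zero_mul,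
    sub_zero]

/-- `Y` is an orthonormal frame and `Z` a gradient at `Y` with orthogonal columns of squared
lengths `β`, as they occur in the line search. -/
structure DiagonalGradient {n p : ℕ} (A : Matrix (Fin n) (Fin n) ℝ)
    (Y Z : Matrix (Fin n) (Fin p) ℝ) (β : Fin p → ℝ) : Prop where
  symm : Aᵀ = A
  orth : Yᵀ * Y = 1
  horizontal : Zᵀ * Y = 0
  gram : Zᵀ * Z = diagonal β
  grad : Zᵀ * (A * Y) = -diagonal β

namespace DiagonalGradient

variable {n p : ℕ} {A : Matrix (Fin n) (Fin n) ℝ} {Y Z : Matrix (Fin n) (Fin p) ℝ} {β : Fin p → ℝ}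

theorem of_grad {X : Matrix (Fin n) (Fin p) ℝ} {W : Matrix (Fin p) (Fin p) ℝ} (hA : Aᵀ = A)
    (hX : Xᵀ * X = 1) (hW : Wᵀ * W = 1)
    (hβ : (SubspaceGD.grad A X)ᵀ * SubspaceGD.grad A X = W * diagonal β * Wᵀ) :
    DiagonalGradient A (X * W) (SubspaceGD.grad A X * W) β := by
  have hd : Wᵀ * (W * diagonal β * Wᵀ) * W = diagonal β := by
    calc Wᵀ * (W * diagonal β * Wᵀ) * W = (Wᵀ * W) * diagonal β * (Wᵀ * W) := by
          simp only [Matrix.mul_assoc]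
      _ = diagonal β := by rw [hW, Matrix.one_mul, Matrix.mul_one]
  refine ⟨hA, ?_, ?_, ?_, ?_⟩
  · rw [transpose_mul, Matrix.mul_assoc, ← Matrix.mul_assoc Xᵀ, hX, Matrix.one_mul, hW]
  · rw [transpose_mul, Matrix.mul_assoc, ← Matrix.mul_assoc _ X, grad_transpose_mul_self hX,
      Matrix.zero_mul, Matrix.mul_zero]
  · rw [transpose_mul, Matrix.mul_assoc, ← Matrix.mul_assoc _ _ W, hβ, ← Matrix.mul_assoc, hd]
  · rw [transpose_mul, Matrix.mul_assoc, ← Matrix.mul_assoc A, ← Matrix.mul_assoc _ _ W,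
      grad_transpose_mul_mul_self hX, hβ, Matrix.neg_mul, Matrix.mul_neg, ← Matrix.mul_assoc, hd]

theorem grad' (h : DiagonalGradient A Y Z β) : Yᵀ * (A * Z) = -diagonal β := by
  have := congrArg transpose h.grad
  rwa [transpose_mul, transpose_mul, h.symm, transpose_transpose, transpose_neg,
    diagonal_transpose, Matrix.mul_assoc] at this

theorem β_eq (h : DiagonalGradient A Y Z β) (i : Fin p) : β i = Z.col i ⬝ᵥ Z.col i := by
  have := congrFun (congrFun h.gram i) i
  rw [diagonal_apply_eq] at this
  exact this.symm

theorem β_nonneg (h : DiagonalGradient A Y Z β) (i : Fin p) : 0 ≤ β i := by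
  rw [h.β_eq]
  exact Finset.sum_nonneg fun i _ => mul_self_nonneg _

theorem orth_step (h : DiagonalGradient A Y Z β) (μ : ℝ) :
    (Y - μ • Z)ᵀ * (Y - μ • Z) = diagonal fun i => 1 + μ ^ 2 * β i := by
  have hYZ : Yᵀ * Z = 0 := by
    rw [← transpose_transpose (Yᵀ * Z), transpose_mul, transpose_transpose, h.horizontal,
      transpose_zero]
  rw [transpose_sub, transpose_smul, Matrix.sub_mul, Matrix.mul_sub, Matrix.mul_sub, h.orth,
    Matrix.smul_mul, Matrix.smul_mul, Matrix.mul_smul, Matrix.mul_smul, h.gram, h.horizontal, hYZ]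
  ext i j
  rcases eq_or_ne i j with rfl | hij
  · simp; ring
  · simp [hij]

theorem quadratic_step (h : DiagonalGradient A Y Z β) (μ : ℝ) (i : Fin p) :
    ((Y - μ • Z)ᵀ * A * (Y - μ • Z)) i i =
      (Yᵀ * A * Y) i i + 2 * β i * μ + (Zᵀ * A * Z) i i * μ ^ 2 := by
  have e₁ := congrFun (congrFun h.grad i) i
  have e₂ := congrFun (congrFun h.grad' i) i
  rw [← Matrix.mul_assoc, neg_apply, diagonal_apply_eq] at e₁ e₂
  simp only [transpose_sub, transpose_smul, Matrix.sub_mul, Matrix.mul_sub, Matrix.smul_mul,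
    Matrix.mul_smul, Matrix.sub_apply, Matrix.smul_apply, smul_eq_mul, e₁, e₂]
  ring

/-- The polar retraction stays on the Stiefel manifold, and the cost there is the line-search
objective. -/
theorem retraction (h : DiagonalGradient A Y Z β) {W : Matrix (Fin p) (Fin p) ℝ}
    (hW : Wᵀ * W = 1) (μ : ℝ) {X' : Matrix (Fin n) (Fin p) ℝ}
    (hX' : X' = (Y - μ • Z) * diagonal (fun i => (√(1 + μ ^ 2 * β i))⁻¹) * Wᵀ) :
    X'ᵀ * X' = 1 ∧ phi A X' = -(1 / 2) * ∑ i,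
      ((Yᵀ * A * Y) i i + 2 * β i * μ + (Zᵀ * A * Z) i i * μ ^ 2) / (1 + β i * μ ^ 2) := by
  have hpos (i : Fin p) : 0 < 1 + μ ^ 2 * β i := by
    have := mul_nonneg (sq_nonneg μ) (h.β_nonneg i)
    linarith
  have hd (i : Fin p) : (√(1 + μ ^ 2 * β i))⁻¹ * (√(1 + μ ^ 2 * β i))⁻¹ =
      (1 + μ ^ 2 * β i)⁻¹ := by
    rw [← mul_inv, mul_self_sqrt (hpos i).le]
  set d : Fin p → ℝ := fun i => (√(1 + μ ^ 2 * β i))⁻¹ with hddef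
  have hW' : W * Wᵀ = 1 := mul_eq_one_comm.mp hW
  have htr : X'ᵀ = W * (diagonal d * (Y - μ • Z)ᵀ) := by
    rw [hX', transpose_mul, transpose_transpose, transpose_mul, diagonal_transpose]
  constructor
  · calc X'ᵀ * X' = W * (diagonal d * ((Y - μ • Z)ᵀ * (Y - μ • Z)) * diagonal d) * Wᵀ := by
          rw [htr, hX']
          simp only [Matrix.mul_assoc]
      _ = 1 := by
          rw [h.orth_step, diagonal_mul_diagonal, diagonal_mul_diagonal]
          have : (fun i => d i * (1 + μ ^ 2 * β i) * d i) = fun _ => (1 : ℝ) := by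
            funext i
            rw [mul_right_comm, hd, inv_mul_cancel₀ (hpos i).ne']
          rw [this, diagonal_one, Matrix.mul_one, hW']
  · have e : X'ᵀ * A * X' =
        W * (diagonal d * ((Y - μ • Z)ᵀ * A * (Y - μ • Z)) * diagonal d * Wᵀ) := by
      rw [htr, hX']
      simp only [Matrix.mul_assoc]
    rw [phi, e, trace_mul_comm, Matrix.mul_assoc, hW, Matrix.mul_one]
    congr 1
    refine Finset.sum_congr rfl fun i _ => ?_
    rw [diag_apply, mul_diagonal, diagonal_mul, h.quadratic_step, mul_right_comm, hd,
      mul_comm (μ ^ 2), div_eq_inv_mul]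

/-- The decrease of one summand of the line-search objective at the step size `1 / L`. -/
theorem summand_lower_bound {α γ β lo L : ℝ} (hL : 0 < L) (hβ : 0 ≤ β) (hα : α ≤ lo + L)
    (hγ : lo * β ≤ γ) (hβL : β ≤ L ^ 2) :
    α + β / (2 * L) ≤ (α + 2 * β * (1 / L) + γ * (1 / L) ^ 2) / (1 + β * (1 / L) ^ 2) := by
  obtain ⟨t, ht⟩ : ∃ t, t = 1 / L := ⟨_, rfl⟩
  have htL : L * t = 1 := by rw [ht]; field_simp
  have ht0 : 0 < t := by rw [ht]; positivity
  have e : β / (2 * L) = β * t / 2 := by rw [ht]; ring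
  rw [← ht, e, le_div_iff₀ (by positivity)]
  -- With the denominator cleared, the first-order gain 2βt pays for βt/2 (the claim), βt (the
  -- curvature, `h₁` and `h₂`) and βt/2 (the product term, `h₄`).
  have h₁ : (α * β - γ) * t ^ 2 ≤ (L * β) * t ^ 2 := by
    gcongr
    nlinarith
  have h₂ : L * β * t ^ 2 = β * t := by linear_combination β * t * htL
  have h₃ : β * t ^ 2 ≤ 1 := by
    calc β * t ^ 2 ≤ L ^ 2 * t ^ 2 := by gcongr
      _ = 1 := by rw [← mul_pow, htL, one_pow]
  have h₄ : β * t / 2 * (β * t ^ 2) ≤ β * t / 2 * 1 := by gcongr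
  linarith

/-- Moving uphill, with step -1/L, cannot push the Rayleigh quotient below `lo`: this gives 2β/L ≤ L
+ β/L. -/
theorem β_le (h : DiagonalGradient A Y Z β) {lo hi : ℝ} (hlt : lo < hi)
    (hlo : ∀ x, lo * (x ⬝ᵥ x) ≤ x ⬝ᵥ A *ᵥ x) (hhi : ∀ x, x ⬝ᵥ A *ᵥ x ≤ hi * (x ⬝ᵥ x))
    (i : Fin p) : β i ≤ (hi - lo) ^ 2 := by
  obtain ⟨L, hL⟩ : ∃ L, L = hi - lo := ⟨_, rfl⟩
  have hL0 : 0 < L := by linarith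
  have hYY : Y.col i ⬝ᵥ Y.col i = 1 := by
    have := congrFun (congrFun h.orth i) i
    rwa [one_apply_eq] at this
  have hx := hlo ((Y - (-(1 / L)) • Z).col i)
  have e₁ : (Y - (-(1 / L)) • Z).col i ⬝ᵥ (Y - (-(1 / L)) • Z).col i =
      1 + (-(1 / L)) ^ 2 * β i := by
    have := congrFun (congrFun (h.orth_step (-(1 / L))) i) i
    rwa [diagonal_apply_eq] at this
  have e₂ := h.quadratic_step (-(1 / L)) i
  rw [Matrix.mul_assoc, Matrix.mul_assoc, Matrix.mul_assoc] at e₂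
  have e₃ : (Y - (-(1 / L)) • Z).col i ⬝ᵥ A *ᵥ (Y - (-(1 / L)) • Z).col i =
      Y.col i ⬝ᵥ A *ᵥ Y.col i + 2 * β i * (-(1 / L)) + Z.col i ⬝ᵥ A *ᵥ Z.col i * (-(1 / L)) ^ 2 :=
    e₂
  have hY := hhi (Y.col i)
  have hZ := hhi (Z.col i)
  rw [← h.β_eq] at hZ
  rw [hYY, mul_one] at hY
  rw [e₁, e₃] at hx
  obtain ⟨t, ht⟩ : ∃ t, t = 1 / L := ⟨_, rfl⟩
  have htL : L * t = 1 := by rw [ht]; field_simp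
  have ht0 : 0 < t := by rw [ht]; positivity
  rw [← ht] at hx
  have hZ' := mul_le_mul_of_nonneg_right hZ (sq_nonneg t)
  have h₁ : L * β i * t ^ 2 = β i * t := by linear_combination β i * t * htL
  have h₂ : β i * t ≤ L := by
    have : hi = lo + L := by linarith
    subst this
    linarith
  rw [← hL]
  calc β i = β i * t * L := by linear_combination -β i * htL
    _ ≤ L * L := by gcongr
    _ = L ^ 2 := (sq L).symm

end DiagonalGradient

/-- One step of gradient descent with exact line search stays on the Stiefel manifold and
decreases the cost proportionally to the squared norm of the gradient. -/
theorem IsRGDStep.descent {n p : ℕ} {A : Matrix (Fin n) (Fin n) ℝ}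
    {X X' : Matrix (Fin n) (Fin p) ℝ} {lo hi : ℝ} (hA : Aᵀ = A) (hX : Xᵀ * X = 1)
    (hlt : lo < hi) (hlo : ∀ x, lo * (x ⬝ᵥ x) ≤ x ⬝ᵥ A *ᵥ x)
    (hhi : ∀ x, x ⬝ᵥ A *ᵥ x ≤ hi * (x ⬝ᵥ x)) (hstep : IsRGDStep A X X') :
    X'ᵀ * X' = 1 ∧
      phi A X' ≤ phi A X - ((grad A X)ᵀ * grad A X).trace / (4 * (hi - lo)) := by
  obtain ⟨W, β, μ, hW, hβ, -, hmin, hX'⟩ := hstep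
  have h := DiagonalGradient.of_grad hA hX hW hβ
  have hL : 0 < hi - lo := sub_pos.2 hlt
  rw [Matrix.sub_mul, Matrix.smul_mul] at hX'
  obtain ⟨h₁, h₂⟩ := h.retraction hW μ hX'
  refine ⟨h₁, ?_⟩
  have hW' : W * Wᵀ = 1 := mul_eq_one_comm.mp hW
  have hsumβ : ∑ i, β i = ((grad A X)ᵀ * grad A X).trace := by
    rw [hβ, trace_mul_comm, ← Matrix.mul_assoc, hW, Matrix.one_mul, trace_diagonal]
  have hphi : phi A X = -(1 / 2) * ∑ i, ((X * W)ᵀ * A * (X * W)) i i := by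
    have e : (X * W)ᵀ * A * (X * W) = Wᵀ * (Xᵀ * A * X * W) := by
      rw [transpose_mul]
      simp only [Matrix.mul_assoc]
    have : ∑ i, ((X * W)ᵀ * A * (X * W)) i i = (Xᵀ * A * X).trace := by
      calc ∑ i, ((X * W)ᵀ * A * (X * W)) i i = (Wᵀ * (Xᵀ * A * X * W)).trace :=
            congrArg trace e
        _ = (Xᵀ * A * X).trace := by
            rw [trace_mul_comm, Matrix.mul_assoc, hW', Matrix.mul_one]
    rw [this, phi]
  -- The exact minimizer is only compared with the step size 1/L.
  have hle := hmin (1 / (hi - lo)) (by positivity)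
  have hterm (i : Fin p) := DiagonalGradient.summand_lower_bound
    (α := ((X * W)ᵀ * A * (X * W)) i i) (γ := ((grad A X * W)ᵀ * A * (grad A X * W)) i i)
    (lo := lo) hL (h.β_nonneg i)
    (by
      have h₃ := hhi ((X * W).col i)
      have h₄ : (X * W).col i ⬝ᵥ (X * W).col i = 1 := by
        have := congrFun (congrFun h.orth i) i
        rwa [one_apply_eq] at this
      rw [h₄] at h₃
      rw [Matrix.mul_assoc]
      refine h₃.trans ?_
      linarith)
    (by
      have h₃ := hlo ((grad A X * W).col i)
      rw [← h.β_eq] at h₃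
      rw [Matrix.mul_assoc]
      exact h₃)
    (h.β_le hlt hlo hhi i)
  have hsum := Finset.sum_le_sum fun i (_ : i ∈ Finset.univ) => hterm i
  rw [Finset.sum_add_distrib, ← Finset.sum_div, hsumβ] at hsum
  rw [h₂, hphi]
  unfold lineObj at hle
  refine hle.trans ?_
  have e : ((grad A X)ᵀ * grad A X).trace / (4 * (hi - lo)) =
      1 / 2 * (((grad A X)ᵀ * grad A X).trace / (2 * (hi - lo))) := by
    field_simp
    norm_num
  rw [e]
  linarith

/-! ### Linear convergence and the iteration count -/

theorem cQ_pos : 0 < cQ := by unfold cQ; positivity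

theorem cQ_le : cQ ≤ 2 / 9 := by
  unfold cQ
  gcongr
  nlinarith [pi_gt_three]

theorem gap_le_spread {n p : ℕ} {A : Matrix (Fin n) (Fin n) ℝ} (hA : A.IsHermitian)
    (hp : 0 < p) (hpn : p < n) : gap hA hp hpn ≤ spread hA (hp.trans hpn) := by
  have h₁ : eig hA ⟨p - 1, by omega⟩ ≤ eig hA ⟨0, hp.trans hpn⟩ :=
    eig_antitone hA (by simp [Fin.le_def])
  have h₂ : eig hA ⟨n - 1, by omega⟩ ≤ eig hA ⟨p, hpn⟩ :=
    eig_antitone hA (by simp [Fin.le_def]; omega)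
  unfold gap spread
  linarith

theorem iterBound_eq {L δ Δ ε : ℝ} :
    iterBound L δ Δ ε = 5 / 4 * cQ⁻¹ * (L / δ) * log⁺ (Δ / (cQ * ε ^ 2 * δ)) + 1 := by
  unfold iterBound cQ
  field_simp
  ring

theorem le_exp_posLog {x : ℝ} (hx : 0 ≤ x) : x ≤ exp (log⁺ x) := by
  rcases hx.eq_or_lt with rfl | hx
  · exact (exp_pos _).le
  · rw [← log_le_iff_le_exp hx]
    exact le_max_right _ _

theorem posLog_le_self {x : ℝ} (hx : 0 ≤ x) : log⁺ x ≤ x :=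
  max_le hx (log_le_self hx)

namespace SpectralSplit

variable {n p : ℕ} {A : Matrix (Fin n) (Fin n) ℝ} {X V : Matrix (Fin n) (Fin p) ℝ}
  {lo b a hi : ℝ}

theorem grDist_sq_le_phi (h : SpectralSplit A V lo b a hi) (hX : Xᵀ * X = 1) (hba : b < a) :
    cQ * (a - b) * grDist X V ^ 2 ≤ phi A X - phi A V := by
  have h₁ := h.gap_mul_sinSq_le hX
  have h₂ := mul_le_mul_of_nonneg_left (grDist_sq_le hX h.orth) (sub_pos.2 hba).le
  linarith

theorem phi_nonneg (h : SpectralSplit A V lo b a hi) (hX : Xᵀ * X = 1) (hba : b < a) :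
    0 ≤ phi A X - phi A V :=
  le_trans (by have := cQ_pos; have := sub_pos.2 hba; positivity) (h.grDist_sq_le_phi hX hba)

/-- The starting radius is chosen so that (L/2) dist² is at most c_Q δ, the basin in which
`contraction` applies. -/
theorem phi_le_of_grDist_le (h : SpectralSplit A V lo b a hi) (hX : Xᵀ * X = 1)
    (hlt : lo < hi) (hba : b < a)
    (hdist : grDist X V ≤ √(2 * cQ * (a - b) / (hi - lo))) :
    phi A X - phi A V ≤ cQ * (a - b) := by
  have hL : 0 < hi - lo := sub_pos.2 hlt
  have hδ : 0 < a - b := sub_pos.2 hba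
  have hc := cQ_pos
  have h₁ := h.le_spread_mul_sinSq hX
  have h₂ : grDist X V ^ 2 ≤ 2 * cQ * (a - b) / (hi - lo) := by
    calc grDist X V ^ 2 ≤ √(2 * cQ * (a - b) / (hi - lo)) ^ 2 :=
          pow_le_pow_left₀ (sqrt_nonneg _) hdist 2
      _ = _ := sq_sqrt (by positivity)
  have h₃ : (hi - lo) * sinSq X V ≤ (hi - lo) * (2 * cQ * (a - b) / (hi - lo)) :=
    mul_le_mul_of_nonneg_left ((sinSq_le_grDist_sq hX h.orth).trans h₂) hL.le
  rw [mul_div_cancel₀ _ hL.ne'] at h₃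
  linarith

/-- One step contracts the error in the cost, as long as that error is small. -/
theorem contraction (h : SpectralSplit A V lo b a hi) (hX : Xᵀ * X = 1) (hlt : lo < hi)
    (hba : b < a) (hsmall : phi A X - phi A V ≤ cQ * (a - b)) {X' : Matrix (Fin n) (Fin p) ℝ}
    (hstep : IsRGDStep A X X') :
    phi A X' - phi A V ≤
      exp (-(4 / 5 * cQ * ((a - b) / (hi - lo)))) * (phi A X - phi A V) := by
  obtain ⟨-, hdesc⟩ := hstep.descent h.symm hX hlt h.lo_le h.le_hi
  have hL : 0 < hi - lo := sub_pos.2 hlt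
  have hδ : 0 < a - b := sub_pos.2 hba
  have hc := cQ_le
  have hf := h.phi_nonneg hX hba
  have hs : sinSq X V ≤ 2 * cQ := by
    have := h.gap_mul_sinSq_le hX
    refine le_of_mul_le_mul_left ?_ hδ
    linarith
  have hpl := h.two_mul_gap_mul_le hX hba.le (by linarith)
  set f := phi A X - phi A V
  set g := ((grad A X)ᵀ * grad A X).trace
  -- The factor 4/5 needs 16 c_Q/5 ≤ 2 (1 - 2 c_Q), that is c_Q ≤ 5/18, which follows from c_Q ≤
  -- 2/9.
  have h₁ : 4 * (4 / 5 * cQ * (a - b)) * f ≤ g := by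
    refine le_trans (mul_le_mul_of_nonneg_right ?_ hf) hpl
    nlinarith
  have h₂ : 4 / 5 * cQ * ((a - b) / (hi - lo)) * f ≤ g / (4 * (hi - lo)) := by
    rw [le_div_iff₀ (by positivity)]
    calc 4 / 5 * cQ * ((a - b) / (hi - lo)) * f * (4 * (hi - lo))
        = 4 * (4 / 5 * cQ * (a - b)) * f := by field_simp
      _ ≤ g := h₁
  have h₃ := mul_le_mul_of_nonneg_right
    (one_sub_le_exp_neg (4 / 5 * cQ * ((a - b) / (hi - lo)))) hf
  refine le_trans ?_ h₃
  linarith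

theorem linear_convergence (h : SpectralSplit A V lo b a hi) (hlt : lo < hi) (hba : b < a)
    {X : ℕ → Matrix (Fin n) (Fin p) ℝ} (hrun : IsRGDRun A X)
    (hdist : grDist (X 0) V ≤ √(2 * cQ * (a - b) / (hi - lo))) (k : ℕ) :
    (X k)ᵀ * X k = 1 ∧ phi A (X k) - phi A V ≤
      exp (-(4 / 5 * cQ * ((a - b) / (hi - lo))) * k) * (phi A (X 0) - phi A V) := by
  have hL : 0 < hi - lo := sub_pos.2 hlt
  have hδ : 0 < a - b := sub_pos.2 hba
  have hc := cQ_pos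
  have h₀ : (X 0)ᵀ * X 0 = 1 := hrun.1
  have hρ : 0 ≤ 4 / 5 * cQ * ((a - b) / (hi - lo)) := by positivity
  induction k with
  | zero => simp [h₀]
  | succ k ih =>
    obtain ⟨hX, hk⟩ := ih
    refine ⟨((hrun.2 k).descent h.symm hX hlt h.lo_le h.le_hi).1, ?_⟩
    have hf := h.phi_nonneg h₀ hba
    have hle : phi A (X k) - phi A V ≤ phi A (X 0) - phi A V := by
      refine hk.trans (mul_le_of_le_one_left hf (exp_le_one_iff.2 ?_))
      exact mul_nonpos_of_nonpos_of_nonneg (by linarith) (Nat.cast_nonneg k)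
    have hstep := h.contraction hX hlt hba
      (hle.trans (h.phi_le_of_grDist_le h₀ hlt hba hdist)) (hrun.2 k)
    refine hstep.trans ((mul_le_mul_of_nonneg_left hk (exp_pos _).le).trans_eq ?_)
    rw [← mul_assoc, ← exp_add]
    push_cast
    ring_nf

theorem exists_iteration (h : SpectralSplit A V lo b a hi) (hlt : lo < hi) (hba : b < a)
    {X : ℕ → Matrix (Fin n) (Fin p) ℝ} (hrun : IsRGDRun A X)
    (hdist : grDist (X 0) V ≤ √(2 * cQ * (a - b) / (hi - lo))) {ε : ℝ} (hε : 0 < ε) :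
    ∃ T : ℕ, (T : ℝ) ≤ iterBound (hi - lo) (a - b) (phi A (X 0) - phi A V) ε ∧
      ∀ k : ℕ, T ≤ k → grDist (X k) V ≤ ε := by
  have hL : 0 < hi - lo := sub_pos.2 hlt
  have hδ : 0 < a - b := sub_pos.2 hba
  have hc := cQ_pos
  have hf := h.phi_nonneg (X := X 0) hrun.1 hba
  set Δ := phi A (X 0) - phi A V
  set ℓ := log⁺ (Δ / (cQ * ε ^ 2 * (a - b))) with hℓ
  have hℓ0 : 0 ≤ ℓ := posLog_nonneg
  -- The coefficient of ℓ is the reciprocal of the rate (4/5) c_Q δ/L; rounding up costs the final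
  -- +1 of the bound.
  refine ⟨⌈5 / 4 * cQ⁻¹ * ((hi - lo) / (a - b)) * ℓ⌉₊, ?_, fun k hk => ?_⟩
  · rw [iterBound_eq]
    exact (Nat.ceil_lt_add_one (by positivity)).le
  · have hk' : 5 / 4 * cQ⁻¹ * ((hi - lo) / (a - b)) * ℓ ≤ k := (Nat.le_ceil _).trans
      (by exact_mod_cast hk)
    obtain ⟨hX, hconv⟩ := h.linear_convergence hlt hba hrun hdist k
    have hρ : ℓ ≤ 4 / 5 * cQ * ((a - b) / (hi - lo)) * k := by
      calc ℓ = 4 / 5 * cQ * ((a - b) / (hi - lo)) *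
            (5 / 4 * cQ⁻¹ * ((hi - lo) / (a - b)) * ℓ) := by
            field_simp
        _ ≤ _ := by gcongr
    have hΔ : Δ ≤ exp ℓ * (cQ * ε ^ 2 * (a - b)) := by
      rw [← div_le_iff₀ (by positivity)]
      exact le_exp_posLog (by positivity)
    have h₁ : phi A (X k) - phi A V ≤ cQ * ε ^ 2 * (a - b) := by
      calc phi A (X k) - phi A V
          ≤ exp (-(4 / 5 * cQ * ((a - b) / (hi - lo))) * k) * Δ := hconv
        _ ≤ exp (-ℓ) * Δ := by
            gcongr
            linarith
        _ ≤ exp (-ℓ) * (exp ℓ * (cQ * ε ^ 2 * (a - b))) := by gcongr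
        _ = cQ * ε ^ 2 * (a - b) := by rw [← mul_assoc, ← exp_add]; simp
    have h₂ := h.grDist_sq_le_phi hX hba
    have h₃ : grDist (X k) V ^ 2 ≤ ε ^ 2 := by
      refine le_of_mul_le_mul_left ?_ (mul_pos hc hδ)
      linarith
    exact (pow_le_pow_iff_left₀ (sqrt_nonneg _) hε.le two_ne_zero).1 h₃

end SpectralSplit

/-! ### Order of the iteration bound -/

theorem iterBound_le {L δ Δ ε : ℝ} (hδ : 0 < δ) (hL : δ ≤ L) (hΔ : 0 ≤ Δ) (hε : 0 < ε) :
    iterBound L δ Δ ε ≤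
      L / δ * (13 * log⁺ (Δ / ε) + 7 * log⁺ (1 / (Δ * δ)) + 33) := by
  have hc : cQ⁻¹ ≤ 5 := by
    have : cQ⁻¹ = π ^ 2 / 2 := by unfold cQ; field_simp
    rw [this]
    nlinarith [pi_lt_d2, pi_pos]
  have hc₀ : 0 < cQ⁻¹ := inv_pos.2 cQ_pos
  have hLδ : 1 ≤ L / δ := (one_le_div hδ).2 hL
  have hx : 0 ≤ log⁺ (Δ / ε) := posLog_nonneg
  have hy : 0 ≤ log⁺ (1 / (Δ * δ)) := posLog_nonneg
  have hlog : log⁺ (Δ / (cQ * ε ^ 2 * δ)) ≤ 2 * log⁺ (Δ / ε) + log⁺ (1 / (Δ * δ)) + 5 := by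
    -- For Δ = 0 both sides vanish, because 1 / 0 = 0; the same convention makes the hidden term
    -- zero in that case.
    have e : Δ / (cQ * ε ^ 2 * δ) = (Δ / ε) ^ 2 * (1 / (Δ * δ)) * cQ⁻¹ := by
      rcases hΔ.eq_or_lt with rfl | hΔ
      · simp
      · have := cQ_pos
        field_simp
    rw [e]
    have h₁ : log⁺ ((Δ / ε) ^ 2) = 2 * log⁺ (Δ / ε) := by
      rw [posLog_pow]
      norm_num
    have h₂ := (posLog_le_self hc₀.le).trans hc
    have h₃ := posLog_mul (x := (Δ / ε) ^ 2 * (1 / (Δ * δ))) (y := cQ⁻¹)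
    have h₄ := posLog_mul (x := (Δ / ε) ^ 2) (y := 1 / (Δ * δ))
    linarith
  rw [iterBound_eq]
  set x := log⁺ (Δ / ε)
  set y := log⁺ (1 / (Δ * δ))
  calc 5 / 4 * cQ⁻¹ * (L / δ) * log⁺ (Δ / (cQ * ε ^ 2 * δ)) + 1
      ≤ 5 / 4 * 5 * (L / δ) * (2 * x + y + 5) + L / δ := by
        gcongr
        exact posLog_nonneg
    _ = L / δ * (25 / 2 * x + 25 / 4 * y + 129 / 4) := by ring
    _ ≤ L / δ * (13 * x + 7 * y + 33) := by
        gcongr <;> linarith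

theorem eventually_iterBound_le {L δ Δ : ℝ} (hδ : 0 < δ) (hL : δ ≤ L) (hΔ : 0 < Δ) :
    ∀ᶠ ε in 𝓝[>] (0 : ℝ), iterBound L δ Δ ε ≤ 33 * (L / δ) * log (Δ / ε) := by
  have hlim : Tendsto (fun ε : ℝ => log (Δ / ε)) (𝓝[>] 0) atTop := by
    simp_rw [div_eq_mul_inv]
    exact tendsto_log_atTop.comp (tendsto_inv_nhdsGT_zero.const_mul_atTop hΔ)
  -- With x = log(Δ/ε) ≥ y + 3, the surplus 20 x absorbs 7 y + 33.
  filter_upwards [hlim.eventually_ge_atTop (log⁺ (1 / (Δ * δ)) + 3), self_mem_nhdsWithin]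
    with ε h₁ hε
  have hy : 0 ≤ log⁺ (1 / (Δ * δ)) := posLog_nonneg
  have hx : log⁺ (Δ / ε) = log (Δ / ε) := max_eq_right (by linarith)
  have hLδ : 0 < L / δ := div_pos (hδ.trans_le hL) hδ
  refine (iterBound_le hδ hL hΔ.le hε).trans ?_
  rw [hx, mul_comm 33, mul_assoc]
  gcongr
  linarith

end SubspaceGD

theorem mainTheorem3 :
    ∃ K : ℝ, 0 < K ∧
    ∀ (n p : ℕ) (hp : 0 < p) (hpn : p < n)
      (A : Matrix (Fin n) (Fin n) ℝ) (hA : A.IsHermitian)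
      (L δ : ℝ) (_ : L = SubspaceGD.spread hA (hp.trans hpn)) (_ : δ = SubspaceGD.gap hA hp hpn)
      (_ : 0 < δ)
      (V : Matrix (Fin n) (Fin p) ℝ) (_ : SubspaceGD.IsDominantBasis hA hpn V)
      (X : ℕ → Matrix (Fin n) (Fin p) ℝ) (_ : SubspaceGD.IsRGDRun A X)
      (_ : SubspaceGD.grDist (X 0) V ≤ √(2 * SubspaceGD.cQ * δ / L))
      (Δ : ℝ) (_ : Δ = SubspaceGD.phi A (X 0) - SubspaceGD.phi A V),
      -- the iteration count
      (∀ ε : ℝ, 0 < ε → ∃ T : ℕ, (T : ℝ) ≤ SubspaceGD.iterBound L δ Δ ε ∧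
        ∀ k : ℕ, T ≤ k → SubspaceGD.grDist (X k) V ≤ ε) ∧
      -- its order, with the hidden logarithmic term written out
      (∀ ε : ℝ, 0 < ε → SubspaceGD.iterBound L δ Δ ε ≤
        K * (L / δ) * (log⁺ (Δ / ε) + log⁺ (1 / (Δ * δ)) + 1)) ∧
      -- its order as the accuracy tends to zero
      (0 < Δ → ∀ᶠ ε in 𝓝[>] (0 : ℝ),
        SubspaceGD.iterBound L δ Δ ε ≤ K * (L / δ) * log (Δ / ε)) := by
  refine ⟨33, by norm_num, ?_⟩
  intro n p hp hpn A hA L δ hL hδ hδ0 V hV X hrun hdist Δ hΔ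
  have hsplit := hV.spectralSplit hA hp hpn (hδ ▸ hδ0)
  have hδL : δ ≤ L := by
    rw [hL, hδ]
    exact SubspaceGD.gap_le_spread hA hp hpn
  have hba := sub_pos.1 (hδ0.trans_eq hδ)
  have hlt := sub_pos.1 ((hδ0.trans_le hδL).trans_eq hL)
  have hΔ0 : 0 ≤ Δ := hΔ ▸ hsplit.phi_nonneg hrun.1 hba
  refine ⟨fun ε hε => ?_, fun ε hε => ?_, fun hΔ' =>
    SubspaceGD.eventually_iterBound_le hδ0 hδL hΔ'⟩
  · subst hL hδ hΔ
    exact hsplit.exists_iteration hlt hba hrun hdist hε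
  · refine (SubspaceGD.iterBound_le hδ0 hδL hΔ0 hε).trans ?_
    have hx : 0 ≤ log⁺ (Δ / ε) := posLog_nonneg
    have hy : 0 ≤ log⁺ (1 / (Δ * δ)) := posLog_nonneg
    have hLδ : 0 < L / δ := div_pos (hδ0.trans_le hδL) hδ0
    rw [mul_comm 33, mul_assoc]
    gcongr
    linarith
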